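/- Let $\otimes$ be one of the following two quantale structures on the complete lattice $[0,1]$ with neutral element $1$: multiplication $u * v = uv$, or the Łukasiewicz tensor $u\odot v=\max(0,u+v-1)$; let $\hom(u,-)$ be the right adjoint of $u\otimes-$. A $[0,1]$-category is a set $A$ with a map $a:A\times A\to[0,1]$ such that $a(x,x)=1$ and $a(x,y)\otimes a(y,z)\le a(x,z)$; its natural order is given by $x\le y\iff a(x,y)=1$, and it is separated if this order is antisymmetric. A $[0,1]$-functor is a map $f$ with $a(x,y)\le b(f(x),f(y))$. A distributor $r$ from $(X,a)$ to $(Y,b)$ is a map $r:X\times Y\to[0,1]$ with $a(x,x')\otimes r(x',y)\le r(x,y)$ and $r(x,y)\otimes b(y,y')\le r(x,y')$. A weighted diagram in $(A,a)$ consists of a $[0,1]$-functor $h:D\to A$ and a distributor $\psi$ from $D$ to the one-point $[0,1]$-category; a colimit of it is an element $x_0\in A$ with $a(x_0,x)=\inf_{z\in D}\hom(\psi(z),a(h(z),x))$ for all $x\in A$. $A$ is finitely cocomplete if all weighted diagrams with finite $D$ have colimits, and a $[0,1]$-functor between finitely cocomplete $[0,1]$-categories is finitely cocontinuous if it preserves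 these colimits. $A$ is Cauchy-complete if every weighted diagram whose weight $\psi$ is a right adjoint distributor (with respect to the composition $(s\cdot r)(x,z)=\sup_y r(x,y)\otimes s(y,z)$) has a colimit. $A$ is $[0,1]$-powered if for all $x\in A$ and $u\in[0,1]$ there is an element $x\pitchfork u\in A$ with $\hom(u,a(y,x))=a(y,x\pitchfork u)$ for all $y\in A$. Let $\mathsf{A}$ be the following category. For $\otimes=\odot$, its objects are the separated, finitely cocomplete, $[0,1]$-powered $[0,1]$-categories $A$ equipped with a commutative monoid structure whose unit is the top element of $A$ and for which multiplication by each element is a finitely cocontinuous $[0,1]$-functor $A\to A$; its morphisms are the finitely cocontinuous $[0,1]$-functors preserving the unit, the multiplication and powers. For $\otimes=*$, the objects moreover carry an additional operation $\ominus:A\times[0,1]\to A$ (on which no equations are imposed), and the morphisms also preserve $\ominus$. The $[0,1]$-category $[0,1]$, with structure $\hom$, multiplication $\otimes$, unit $1$ (and, for $\otimes=*$, $u\ominus v=\max(u-v,0)$), is an object of $\mathsf{A}$. A partially ordered compact space is a compact space $X$ with a partial order whose graph is closed in $X\times X$; for such $X$, let $CX\in\mathsf{A}$ be the set of all continuous order-reversing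 maps $\psi:X\to[0,1]$ (that is, monotone continuous maps $X\to[0,1]^{\mathrm{op}}$), with $a(\psi_1,\psi_2)=\inf_{x\in X}\hom(\psi_1(x),\psi_2(x))$ and all operations defined pointwise. Then, for each of the two choices of $\otimes$ and every object $A$ of $\mathsf{A}$, the following are equivalent: 1. $A\simeq CX$ in $\mathsf{A}$ for some partially ordered compact space $X$; 2. $A$ is Cauchy-complete and the morphisms $A\to[0,1]$ in $\mathsf{A}$ separate the points of $A$. -/

import Mathlib

universe u v w

namespace EnrichedSW

open unitInterval

/-- A continuous t-norm: a commutative quantale structure on the complete lattice `[0,1]` whose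
neutral element is `1`, continuous for the Euclidean topology. -/
structure TNorm where
  tensor : I → I → I
  tensor_comm : ∀ a b, tensor a b = tensor b a
  tensor_assoc : ∀ a b c, tensor (tensor a b) c = tensor a (tensor b c)
  tensor_one : ∀ a, tensor a 1 = a
  tensor_sSup : ∀ (a : I) (S : Set I), tensor a (sSup S) = ⨆ b ∈ S, tensor a b
  continuous_tensor : Continuous fun p : I × I => tensor p.1 p.2

namespace TNorm

/-- The internal hom of the quantale: `hom a` is right adjoint to `tensor a`. -/
noncomputable def hom (T : TNorm) (a b : I) : I := sSup {c | T.tensor a c ≤ b}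

variable (T : TNorm)

theorem tensor_iSup {ι : Sort*} (a : I) (f : ι → I) :
    T.tensor a (⨆ i, f i) = ⨆ i, T.tensor a (f i) := by
  rw [iSup, T.tensor_sSup, iSup_range]

theorem tensor_mono_right (a : I) {b c : I} (h : b ≤ c) : T.tensor a b ≤ T.tensor a c := by
  have h1 := T.tensor_sSup a {b, c}
  rw [sSup_pair, sup_eq_right.2 h] at h1
  rw [h1]
  exact le_iSup₂ (f := fun d (_ : d ∈ ({b, c} : Set I)) => T.tensor a d) b (by simp)

theorem tensor_mono {a b c d : I} (h : a ≤ b) (h' : c ≤ d) : T.tensor a c ≤ T.tensor b d := by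
  refine (T.tensor_mono_right a h').trans ?_
  rw [T.tensor_comm a, T.tensor_comm b]
  exact T.tensor_mono_right d h

theorem le_hom_iff {a b c : I} : c ≤ T.hom a b ↔ T.tensor a c ≤ b := by
  refine ⟨fun h => ?_, fun h => le_sSup h⟩
  refine (T.tensor_mono_right a h).trans ?_
  rw [hom, T.tensor_sSup]
  exact iSup₂_le fun d hd => hd

theorem tensor_hom_le (a b : I) : T.tensor a (T.hom a b) ≤ b := T.le_hom_iff.1 le_rfl

theorem hom_eq_of_adj {a b d : I} (h : ∀ c, T.tensor a c ≤ b ↔ c ≤ d) : T.hom a b = d :=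
  eq_of_forall_le_iff fun c => by rw [T.le_hom_iff, h]

theorem one_le_hom_iff {a b : I} : 1 ≤ T.hom a b ↔ a ≤ b := by
  rw [T.le_hom_iff, T.tensor_one]

theorem hom_tensor (a b c : I) : T.hom (T.tensor a b) c = T.hom b (T.hom a c) :=
  eq_of_forall_le_iff fun d => by
    rw [T.le_hom_iff, T.le_hom_iff, T.le_hom_iff, T.tensor_assoc]

theorem hom_comm (a b c : I) : T.hom a (T.hom b c) = T.hom b (T.hom a c) := by
  rw [← T.hom_tensor, ← T.hom_tensor, T.tensor_comm]

theorem hom_iInf {ι : Sort*} (a : I) (f : ι → I) : T.hom a (⨅ i, f i) = ⨅ i, T.hom a (f i) :=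
  eq_of_forall_le_iff fun d => by
    simp only [T.le_hom_iff, le_iInf_iff]

theorem iSup_hom {ι : Sort*} (f : ι → I) (c : I) : T.hom (⨆ i, f i) c = ⨅ i, T.hom (f i) c :=
  eq_of_forall_le_iff fun d => by
    simp only [T.le_hom_iff, le_iInf_iff, T.tensor_comm _ d, T.tensor_iSup, iSup_le_iff]

theorem hom_trans (a b c : I) : T.tensor (T.hom a b) (T.hom b c) ≤ T.hom a c := by
  rw [T.le_hom_iff, ← T.tensor_assoc]
  exact (T.tensor_mono (T.tensor_hom_le a b) le_rfl).trans (T.tensor_hom_le b c)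

theorem hom_mono_right (a : I) {b c : I} (h : b ≤ c) : T.hom a b ≤ T.hom a c :=
  T.le_hom_iff.2 ((T.tensor_hom_le a b).trans h)

theorem hom_le_hom_tensor (a b c : I) :
    T.hom b c ≤ T.hom (T.tensor a b) (T.tensor a c) := by
  rw [T.le_hom_iff, T.tensor_assoc]
  exact T.tensor_mono_right a (T.tensor_hom_le b c)

/-- The copower formula for a weighted colimit, tested against `c`. -/
theorem iSup_tensor_hom {ι : Sort*} (f g : ι → I) (c : I) :
    T.hom (⨆ i, T.tensor (f i) (g i)) c = ⨅ i, T.hom (g i) (T.hom (f i) c) := by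
  simp only [T.iSup_hom, T.hom_tensor]

end TNorm

/-! ### Categories enriched in `([0,1], ⊗, 1)` -/

structure VCat (T : TNorm) : Type (u + 1) where
  carrier : Type u
  hom : carrier → carrier → I
  one_le_hom : ∀ x, 1 ≤ hom x x
  hom_trans : ∀ x y z, T.tensor (hom x y) (hom y z) ≤ hom x z

/-- The one-point `[0,1]`-category `G = (1, k)`. -/
def VCat.one (T : TNorm) : VCat.{0} T where
  carrier := Unit
  hom _ _ := 1
  one_le_hom _ := le_rfl
  hom_trans _ _ _ := (T.tensor_one 1).le

/-- The natural order of a `[0,1]`-category. -/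
def VCat.LE {T : TNorm} (X : VCat.{u} T) (x y : X.carrier) : Prop := 1 ≤ X.hom x y

def VCat.IsSeparated {T : TNorm} (X : VCat.{u} T) : Prop :=
  ∀ x y, X.LE x y → X.LE y x → x = y

def IsVFunctor {T : TNorm} (X : VCat.{u} T) (Y : VCat.{v} T) (f : X.carrier → Y.carrier) : Prop :=
  ∀ x y, X.hom x y ≤ Y.hom (f x) (f y)

/-- Composition `s · r` of `[0,1]`-relations `r : X ⇸ Y` and `s : Y ⇸ Z`. -/
noncomputable def relComp (T : TNorm) {X : Type u} {Y : Type v} {Z : Type w} (s : Y → Z → I)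
    (r : X → Y → I) (x : X) (z : Z) : I :=
  ⨆ y, T.tensor (r x y) (s y z)

/-- `r : X ⇸ Y` is a distributor: `r · a ≤ r` and `b · r ≤ r`. -/
def IsDistributor {T : TNorm} (X : VCat.{u} T) (Y : VCat.{v} T) (r : X.carrier → Y.carrier → I) :
    Prop :=
  relComp T r X.hom ≤ r ∧ relComp T Y.hom r ≤ r

/-- A distributor `r : X ⇸ Y` is right adjoint if there is a distributor `l : Y ⇸ X`
with `1 ≤ r · l` and `l · r ≤ 1`, where `1` stands for the identity distributors. -/
def IsRightAdjointDistributor {T : TNorm} (X : VCat.{u} T) (Y : VCat.{v} T)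
    (r : X.carrier → Y.carrier → I) : Prop :=
  IsDistributor X Y r ∧ ∃ l : Y.carrier → X.carrier → I, IsDistributor Y X l ∧
    Y.hom ≤ relComp T r l ∧ relComp T l r ≤ X.hom

/-- `x₀` is a colimit in `X` of `h : D → X` weighted by `ψ : D ⇸ G`. -/
def IsColimit {T : TNorm} (X : VCat.{u} T) (D : VCat.{v} T) (h : D.carrier → X.carrier)
    (ψ : D.carrier → (VCat.one T).carrier → I) (x₀ : X.carrier) : Prop :=
  ∀ x, X.hom x₀ x = ⨅ z, T.hom (ψ z ()) (X.hom (h z) x)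

/-- Every weighted diagram of finite shape has a colimit. As every finite set is in bijection
with one in `Type`, shapes in `Type` suffice. -/
def FinCocomplete {T : TNorm} (X : VCat.{u} T) : Prop :=
  ∀ (D : VCat.{0} T) (h : D.carrier → X.carrier) (ψ : D.carrier → (VCat.one T).carrier → I),
    Finite D.carrier → IsVFunctor D X h → IsDistributor D (VCat.one T) ψ →
      ∃ x₀, IsColimit X D h ψ x₀

/-- `f` is a `[0,1]`-functor which preserves all weighted colimits of finite shape. -/
def FinCocontinuous {T : TNorm} (X : VCat.{u} T) (Y : VCat.{v} T) (f : X.carrier → Y.carrier) :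
    Prop :=
  IsVFunctor X Y f ∧
    ∀ (D : VCat.{0} T) (h : D.carrier → X.carrier) (ψ : D.carrier → (VCat.one T).carrier → I),
      Finite D.carrier → IsVFunctor D X h → IsDistributor D (VCat.one T) ψ →
        ∀ x₀, IsColimit X D h ψ x₀ → IsColimit Y D (fun z => f (h z)) ψ (f x₀)

/-- Every diagram weighted by a right adjoint distributor `ψ : D ⇸ G` has a colimit. -/
def IsCauchyComplete {T : TNorm} (X : VCat.{u} T) : Prop :=
  ∀ (D : VCat.{u} T) (h : D.carrier → X.carrier) (ψ : D.carrier → (VCat.one T).carrier → I),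
    IsVFunctor D X h → IsRightAdjointDistributor D (VCat.one T) ψ → ∃ x₀, IsColimit X D h ψ x₀

/-- `p` is the `c`-power of `x`. -/
def IsPower {T : TNorm} (X : VCat.{u} T) (x : X.carrier) (c : I) (p : X.carrier) : Prop :=
  ∀ y, T.hom c (X.hom y x) = X.hom y p

def IsPowered {T : TNorm} (X : VCat.{u} T) : Prop := ∀ x c, ∃ p, IsPower X x c p

def PreservesPowers {T : TNorm} (X : VCat.{u} T) (Y : VCat.{v} T) (f : X.carrier → Y.carrier) :
    Prop :=
  ∀ x c p, IsPower X x c p → IsPower Y (f x) c (f p)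

theorem IsColimit.unique {T : TNorm} {X : VCat.{u} T} (hX : X.IsSeparated) {D : VCat.{v} T}
    {h : D.carrier → X.carrier} {ψ : D.carrier → (VCat.one T).carrier → I} {x y : X.carrier}
    (hx : IsColimit X D h ψ x) (hy : IsColimit X D h ψ y) : x = y := by
  apply hX
  · rw [VCat.LE, hx y, ← hy y]
    exact X.one_le_hom y
  · rw [VCat.LE, hy x, ← hx x]
    exact X.one_le_hom x

theorem FinCocontinuous.id {T : TNorm} (X : VCat.{u} T) : FinCocontinuous X X fun x => x :=
  ⟨fun _ _ => le_rfl, fun _ _ _ _ _ _ _ h => h⟩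

theorem FinCocontinuous.comp {T : TNorm} {X : VCat.{u} T} {Y : VCat.{v} T} {Z : VCat.{w} T}
    {g : Y.carrier → Z.carrier} {f : X.carrier → Y.carrier} (hg : FinCocontinuous Y Z g)
    (hf : FinCocontinuous X Y f) : FinCocontinuous X Z fun x => g (f x) :=
  ⟨fun x y => (hf.1 x y).trans (hg.1 _ _), fun D h ψ hD hh hψ x₀ hx =>
    hg.2 D (fun z => f (h z)) ψ hD (fun a b => (hh a b).trans (hf.1 _ _)) hψ _
      (hf.2 D h ψ hD hh hψ x₀ hx)⟩

/-! ### Commutative monoids in separated finitely cocomplete `[0,1]`-categories -/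

/-- A commutative monoid in the category of separated finitely cocomplete `[0,1]`-categories:
the unit is the top element and multiplication by each element is finitely cocontinuous. -/
structure MonObj (T : TNorm) : Type (u + 1) extends VCat.{u} T where
  separated : toVCat.IsSeparated
  finCocomplete : FinCocomplete toVCat
  mul : carrier → carrier → carrier
  unit : carrier
  mul_comm : ∀ x y, mul x y = mul y x
  mul_assoc : ∀ x y z, mul (mul x y) z = mul x (mul y z)
  mul_unit : ∀ x, mul x unit = x
  le_unit : ∀ x, toVCat.LE x unit
  mul_finCocontinuous : ∀ x, FinCocontinuous toVCat toVCat (mul x)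

/-- A `[0,1]`-powered commutative monoid. -/
structure PowMonObj (T : TNorm) : Type (u + 1) extends MonObj.{u} T where
  powered : IsPowered toVCat

/-- Morphisms: finitely cocontinuous `[0,1]`-functors which preserve the monoid structure and
powers. -/
@[ext]
structure PowMonHom {T : TNorm} (A : PowMonObj.{u} T) (B : PowMonObj.{v} T) : Type (max u v) where
  toFun : A.carrier → B.carrier
  finCocontinuous : FinCocontinuous A.toVCat B.toVCat toFun
  map_unit : toFun A.unit = B.unit
  map_mul : ∀ x y, toFun (A.mul x y) = B.mul (toFun x) (toFun y)
  preservesPowers : PreservesPowers A.toVCat B.toVCat toFun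

def PowMonHom.id {T : TNorm} (A : PowMonObj.{u} T) : PowMonHom A A where
  toFun x := x
  finCocontinuous := FinCocontinuous.id _
  map_unit := rfl
  map_mul _ _ := rfl
  preservesPowers _ _ _ h := h

def PowMonHom.comp {T : TNorm} {A : PowMonObj.{u} T} {B : PowMonObj.{v} T} {C : PowMonObj.{w} T}
    (g : PowMonHom B C) (f : PowMonHom A B) : PowMonHom A C where
  toFun x := g.toFun (f.toFun x)
  finCocontinuous := g.finCocontinuous.comp f.finCocontinuous
  map_unit := by rw [f.map_unit, g.map_unit]
  map_mul x y := by rw [f.map_mul, g.map_mul]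
  preservesPowers x c p h := g.preservesPowers _ _ _ (f.preservesPowers x c p h)

instance (T : TNorm) : CategoryTheory.Category (PowMonObj.{u} T) where
  Hom A B := PowMonHom A B
  id A := PowMonHom.id A
  comp f g := PowMonHom.comp g f

/-- A `[0,1]`-powered commutative monoid with an additional operation `⊖ : A × [0,1] → A`.
No equations are imposed on this operation, so that any axiomatisation of `⊖` gives a full
subcategory; the objects `[0,1]` and `CX` below carry truncated minus. -/
structure MinusObj (T : TNorm) : Type (u + 1) extends PowMonObj.{u} T where
  minus : carrier → I → carrier

/-- Morphisms which in addition preserve `⊖`. -/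
@[ext]
structure MinusHom {T : TNorm} (A : MinusObj.{u} T) (B : MinusObj.{v} T) : Type (max u v) extends
    PowMonHom A.toPowMonObj B.toPowMonObj where
  map_minus : ∀ x c, toFun (A.minus x c) = B.minus (toFun x) c

instance (T : TNorm) : CategoryTheory.Category (MinusObj.{u} T) where
  Hom A B := MinusHom A B
  id A := { PowMonHom.id A.toPowMonObj with map_minus := fun _ _ => rfl }
  comp {A B C} f g :=
    { PowMonHom.comp g.toPowMonHom f.toPowMonHom with
      map_minus := fun x c => by
        change g.toFun (f.toFun (A.minus x c)) = _
        rw [f.map_minus, g.map_minus]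
        rfl }

/-! ### The object `[0,1]` -/

/-- Truncated minus on `[0,1]`. -/
def tminus (a b : I) : I :=
  ⟨max (a.1 - b.1) 0, le_max_right _ _, max_le (by linarith [a.2.2, b.2.1]) zero_le_one⟩

/-- The `[0,1]`-category `[0,1]`, with structure `hom`. -/
noncomputable def unitVCat (T : TNorm) : VCat.{0} T where
  carrier := I
  hom a b := T.hom a b
  one_le_hom _ := T.one_le_hom_iff.2 le_rfl
  hom_trans := T.hom_trans

theorem unitVCat_isSeparated (T : TNorm) : (unitVCat T).IsSeparated :=
  fun (a b : I) h h' =>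
    le_antisymm (α := I) (T.one_le_hom_iff (a := a) (b := b) |>.1 h)
      (T.one_le_hom_iff (a := b) (b := a) |>.1 h')

theorem unitVCat_isColimit (T : TNorm) (D : VCat.{v} T) (h : D.carrier → I)
    (ψ : D.carrier → (VCat.one T).carrier → I) :
    IsColimit (unitVCat T) D h ψ (⨆ z, T.tensor (h z) (ψ z ()) : I) :=
  fun c => T.iSup_tensor_hom h (fun z => ψ z ()) c

theorem unitVCat_tensor_finCocontinuous (T : TNorm) (a : I) :
    FinCocontinuous (unitVCat T) (unitVCat T) (T.tensor a : I → I) := by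
  refine ⟨fun b c => T.hom_le_hom_tensor a b c, fun D (h : D.carrier → I) ψ _ _ _ x₀ hx => ?_⟩
  have h1 : T.tensor a (⨆ z, T.tensor (h z) (ψ z ())) =
      ⨆ z, T.tensor (T.tensor a (h z)) (ψ z ()) := by
    simp only [T.tensor_iSup, T.tensor_assoc]
  have h2 : x₀ = (⨆ z, T.tensor (h z) (ψ z ()) : I) :=
    hx.unique (unitVCat_isSeparated T) (unitVCat_isColimit T D h ψ)
  subst h2
  exact h1 ▸ unitVCat_isColimit T D (fun z => T.tensor a (h z)) ψ

/-- `[0,1]` as an object, with multiplication `⊗`. -/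
noncomputable def unitObj (T : TNorm) : PowMonObj.{0} T where
  toVCat := unitVCat T
  separated := unitVCat_isSeparated T
  finCocomplete D h ψ _ _ _ := ⟨_, unitVCat_isColimit T D h ψ⟩
  mul := T.tensor
  unit := (1 : I)
  mul_comm := T.tensor_comm
  mul_assoc := T.tensor_assoc
  mul_unit := T.tensor_one
  le_unit (x : I) := T.one_le_hom_iff.2 x.2.2
  mul_finCocontinuous := unitVCat_tensor_finCocontinuous T
  powered a c := ⟨T.hom c a, fun (b : I) => T.hom_comm c b a⟩

noncomputable def unitMinusObj (T : TNorm) : MinusObj.{0} T where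
  toPowMonObj := unitObj T
  minus := tminus

/-! ### The objects `CX` -/

/-- A partially ordered compact space: a compact space with a partial order whose graph is
closed. -/
structure PosComp : Type (u + 1) where
  carrier : Type u
  [topologicalSpace : TopologicalSpace carrier]
  [partialOrder : PartialOrder carrier]
  [compactSpace : CompactSpace carrier]
  [orderClosedTopology : OrderClosedTopology carrier]

attribute [instance] PosComp.topologicalSpace PosComp.partialOrder PosComp.compactSpace
  PosComp.orderClosedTopology

/-- The monotone continuous maps `X → [0,1]ᵒᵖ`, that is, the antitone continuous maps
`X → [0,1]`. -/
def CMap (X : PosComp.{u}) : Type u := {f : C(X.carrier, I) // Antitone f}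

instance (X : PosComp.{u}) : FunLike (CMap X) X.carrier I where
  coe f := f.1
  coe_injective _ _ h := Subtype.ext (DFunLike.coe_injective h)

namespace CMap

variable {X : PosComp.{u}}

theorem continuous (f : CMap X) : Continuous f := f.1.continuous

theorem antitone (f : CMap X) : Antitone f := f.2

def mk' (f : X.carrier → I) (hf : Continuous f) (hf' : Antitone f) : CMap X := ⟨⟨f, hf⟩, hf'⟩

@[simp] theorem mk'_apply (f : X.carrier → I) (hf : Continuous f) (hf' : Antitone f)
    (x : X.carrier) : mk' f hf hf' x = f x := rfl

/-- Pointwise tensor. -/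
def tensor (T : TNorm) (f g : CMap X) : CMap X :=
  mk' (fun x => T.tensor (f x) (g x))
    (T.continuous_tensor.comp (f.continuous.prodMk g.continuous))
    fun _ _ h => T.tensor_mono (f.antitone h) (g.antitone h)

/-- Pointwise truncated minus. -/
def minus (f : CMap X) (c : I) : CMap X :=
  mk' (fun x => tminus (f x) c)
    (Continuous.subtype_mk
      (((continuous_subtype_val.comp f.continuous).sub continuous_const).max continuous_const) _)
    fun x y h => by
      have h1 : ((f y : I) : ℝ) ≤ f x := f.antitone h
      exact max_le_max (sub_le_sub_right h1 _) le_rfl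

/-- The constant function `1`. -/
def one (X : PosComp.{u}) : CMap X := mk' (fun _ => 1) continuous_const fun _ _ _ => le_rfl

/-- The pointwise weighted finite colimit. -/
noncomputable def colim (T : TNorm) {D : Type v} [Finite D] (h : D → CMap X) (ψ : D → I) :
    CMap X :=
  mk' (fun x => ⨆ z, T.tensor (h z x) (ψ z))
    (by
      have := Fintype.ofFinite D
      simp only [← Finset.sup_univ_eq_iSup]
      refine Continuous.finset_sup_apply fun z _ => ?_
      exact T.continuous_tensor.comp ((h z).continuous.prodMk continuous_const))
    fun _ _ hxy => iSup_mono fun z => T.tensor_mono ((h z).antitone hxy) le_rfl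

/-- The `[0,1]`-category structure of `CX`. -/
noncomputable def vcat (T : TNorm) (X : PosComp.{u}) : VCat.{u} T where
  carrier := CMap X
  hom f g := ⨅ x, T.hom (f x) (g x)
  one_le_hom _ := le_iInf fun _ => T.one_le_hom_iff.2 le_rfl
  hom_trans f g k := le_iInf fun x =>
    (T.tensor_mono (iInf_le _ x) (iInf_le _ x)).trans (T.hom_trans (f x) (g x) (k x))

theorem vcat_le_iff (T : TNorm) (f g : CMap X) : (vcat T X).LE f g ↔ ∀ x, f x ≤ g x :=
  le_iInf_iff.trans (forall_congr' fun _ => T.one_le_hom_iff)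

theorem vcat_isSeparated (T : TNorm) (X : PosComp.{u}) : (vcat T X).IsSeparated :=
  fun (f g : CMap X) h h' => DFunLike.ext f g fun x =>
    le_antisymm ((vcat_le_iff T f g).1 h x) ((vcat_le_iff T g f).1 h' x)

theorem vcat_isColimit (T : TNorm) (D : VCat.{v} T) [Finite D.carrier] (h : D.carrier → CMap X)
    (ψ : D.carrier → (VCat.one T).carrier → I) :
    IsColimit (vcat T X) D h ψ (colim T h fun z => ψ z ()) := by
  intro (g : CMap X)
  change (⨅ x, T.hom (⨆ z, T.tensor (h z x) (ψ z ())) (g x)) =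
    ⨅ z, T.hom (ψ z ()) (⨅ x, T.hom (h z x) (g x))
  simp only [T.iSup_tensor_hom, T.hom_iInf]
  exact iInf_comm

theorem tensor_comm (T : TNorm) (f g : CMap X) : tensor T f g = tensor T g f :=
  DFunLike.ext _ _ fun x => T.tensor_comm (f x) (g x)

theorem tensor_assoc (T : TNorm) (f g k : CMap X) :
    tensor T (tensor T f g) k = tensor T f (tensor T g k) :=
  DFunLike.ext _ _ fun x => T.tensor_assoc (f x) (g x) (k x)

theorem tensor_one (T : TNorm) (f : CMap X) : tensor T f (one X) = f :=
  DFunLike.ext _ _ fun x => T.tensor_one (f x)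

theorem tensor_finCocontinuous (T : TNorm) (f : CMap X) :
    FinCocontinuous (vcat T X) (vcat T X) (tensor T f) := by
  refine ⟨fun (g k : CMap X) => iInf_mono fun x => T.hom_le_hom_tensor (f x) (g x) (k x),
    fun D (h : D.carrier → CMap X) ψ _ _ _ x₀ hx => ?_⟩
  have h1 : tensor T f (colim T h fun z => ψ z ()) =
      colim T (fun z => tensor T f (h z)) fun z => ψ z () :=
    DFunLike.ext _ _ fun x => by
      change T.tensor (f x) (⨆ z, T.tensor (h z x) (ψ z ())) =
        ⨆ z, T.tensor (T.tensor (f x) (h z x)) (ψ z ())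
      simp only [T.tensor_iSup, T.tensor_assoc]
  have h2 : x₀ = colim T h fun z => ψ z () :=
    hx.unique (vcat_isSeparated T X) (vcat_isColimit T D h ψ)
  subst h2
  exact h1 ▸ vcat_isColimit T D (fun z => tensor T f (h z)) ψ

/-- Pointwise powers. -/
noncomputable def power (T : TNorm) (hT : ∀ c, Continuous (T.hom c)) (f : CMap X) (c : I) :
    CMap X :=
  mk' (fun x => T.hom c (f x)) ((hT c).comp f.continuous)
    fun _ _ h => T.hom_mono_right c (f.antitone h)

theorem power_isPower (T : TNorm) (hT : ∀ c, Continuous (T.hom c)) (f : CMap X) (c : I) :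
    IsPower (vcat T X) f c (power T hT f c) := by
  intro (g : CMap X)
  change T.hom c (⨅ x, T.hom (g x) (f x)) = ⨅ x, T.hom (g x) (T.hom c (f x))
  simp only [T.hom_iInf, T.hom_comm c]

/-- `CX` as an object, all operations being pointwise. -/
noncomputable def obj (T : TNorm) (hT : ∀ c, Continuous (T.hom c)) (X : PosComp.{u}) :
    PowMonObj.{u} T where
  toVCat := vcat T X
  separated := vcat_isSeparated T X
  finCocomplete D h ψ _ _ _ := ⟨_, vcat_isColimit T D h ψ⟩
  mul := tensor T
  unit := one X
  mul_comm := tensor_comm T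
  mul_assoc := tensor_assoc T
  mul_unit := tensor_one T
  le_unit (f : CMap X) := (vcat_le_iff T f (one X)).2 fun x => (f x).2.2
  mul_finCocontinuous := tensor_finCocontinuous T
  powered (f : CMap X) c := ⟨power T hT f c, power_isPower T hT f c⟩

noncomputable def minusObj (T : TNorm) (hT : ∀ c, Continuous (T.hom c)) (X : PosComp.{u}) :
    MinusObj.{u} T where
  toPowMonObj := obj T hT X
  minus := minus

end CMap

/-! ### The Łukasiewicz tensor and multiplication -/

theorem tensor_sSup_of_adj (t r : I → I → I) (h : ∀ a b c, t a c ≤ b ↔ c ≤ r a b) (a : I)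
    (S : Set I) : t a (sSup S) = ⨆ b ∈ S, t a b :=
  (show GaloisConnection (t a) (r a) from fun c b => h a b c).l_sSup

def lukFun (a b : I) : I :=
  ⟨max 0 (a.1 + b.1 - 1), le_max_left _ _, max_le zero_le_one (by linarith [a.2.2, b.2.2])⟩

def lukHom (a b : I) : I :=
  ⟨min 1 (1 - a.1 + b.1), le_min zero_le_one (by linarith [a.2.2, b.2.1]), min_le_left _ _⟩

theorem luk_adj (a b c : I) : lukFun a c ≤ b ↔ c ≤ lukHom a b := by
  rw [← Subtype.coe_le_coe, ← Subtype.coe_le_coe]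
  simp only [lukFun, lukHom, max_le_iff, le_min_iff]
  exact ⟨fun h => ⟨c.2.2, by linarith [h.2]⟩, fun h => ⟨b.2.1, by linarith [h.2]⟩⟩

/-- The Łukasiewicz tensor `a ⊙ b = max 0 (a + b - 1)`. -/
def luk : TNorm where
  tensor := lukFun
  tensor_comm a b := Subtype.ext (by simp only [lukFun, add_comm])
  tensor_assoc a b c := Subtype.ext (by
    have ha := a.2; have hb := b.2; have hc := c.2
    simp only [lukFun]
    rcases max_cases 0 (a.1 + b.1 - 1) with h1 | h1 <;>
    rcases max_cases 0 (b.1 + c.1 - 1) with h2 | h2 <;>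
    rw [h1.1, h2.1] <;>
    grind)
  tensor_one a := Subtype.ext (by simp [lukFun, a.2.1])
  tensor_sSup := tensor_sSup_of_adj lukFun lukHom luk_adj
  continuous_tensor := by
    unfold lukFun
    fun_prop

theorem luk_hom (a b : I) : luk.hom a b = lukHom a b :=
  luk.hom_eq_of_adj fun c => luk_adj a b c

theorem luk_hom_continuous (c : I) : Continuous (luk.hom c) := by
  rw [funext (luk_hom c)]
  unfold lukHom
  fun_prop

noncomputable def multHom (a b : I) : I :=
  if a.1 = 0 then 1 else
    ⟨min (b.1 / a.1) 1, le_min (div_nonneg b.2.1 a.2.1) zero_le_one, min_le_right _ _⟩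

theorem mult_adj (a b c : I) : a * c ≤ b ↔ c ≤ multHom a b := by
  unfold multHom
  rw [← Subtype.coe_le_coe, Set.Icc.coe_mul]
  split_ifs with h
  · rw [h, zero_mul]
    exact ⟨fun _ => c.2.2, fun _ => b.2.1⟩
  · have ha : 0 < a.1 := lt_of_le_of_ne a.2.1 (Ne.symm h)
    rw [← Subtype.coe_le_coe]
    simp only [le_min_iff]
    rw [le_div_iff₀ ha, mul_comm]
    exact ⟨fun h => ⟨h, c.2.2⟩, fun h => h.1⟩

/-- Multiplication on `[0,1]`. -/
noncomputable def mult : TNorm where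
  tensor a b := a * b
  tensor_comm := mul_comm
  tensor_assoc := mul_assoc
  tensor_one := mul_one
  tensor_sSup := tensor_sSup_of_adj (fun a b => a * b) multHom mult_adj
  continuous_tensor := continuous_mul

theorem mult_hom (a b : I) : mult.hom a b = multHom a b :=
  mult.hom_eq_of_adj fun c => mult_adj a b c

theorem mult_hom_continuous (c : I) : Continuous (mult.hom c) := by
  rw [funext (mult_hom c)]
  unfold multHom
  split_ifs with h
  · exact continuous_const
  · fun_prop

/-! ### The category `𝒜` and its objects `CX`, for each of the two tensors -/

/-- The category `𝒜` for the Łukasiewicz tensor. -/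
abbrev LukCat : Type (u + 1) := PowMonObj.{u} luk

/-- The category `𝒜` for multiplication. -/
abbrev MultCat : Type (u + 1) := MinusObj.{u} mult

noncomputable def LukCat.C (X : PosComp.{u}) : LukCat.{u} := CMap.obj luk luk_hom_continuous X

noncomputable def MultCat.C (X : PosComp.{u}) : MultCat.{u} :=
  CMap.minusObj mult mult_hom_continuous X

/-- The morphisms `A → [0,1]` of `𝒜` separate the points of `A`. -/
def LukCat.HasEnoughCharacters (A : LukCat.{u}) : Prop :=
  ∀ a b : A.carrier, (∀ φ : PowMonHom A (unitObj luk), φ.toFun a = φ.toFun b) → a = b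

/-- The morphisms `A → [0,1]` of `𝒜` separate the points of `A`. -/
def MultCat.HasEnoughCharacters (A : MultCat.{u}) : Prop :=
  ∀ a b : A.carrier, (∀ φ : MinusHom A (unitMinusObj mult), φ.toFun a = φ.toFun b) → a = b

end EnrichedSW

/-! The argument is a Stone duality with an enriched Stone–Weierstraß theorem at its core. The
characters of `A` form a closed subset of the product of copies of `[0,1]ᵒᵖ` indexed by `A`: each
condition on a character involves finitely many coordinates and continuous operations
(`isClosed_characters`). This subset is therefore a partially ordered compact space `X`, and
evaluation is a morphism `A → CX`, injective when characters separate points.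

An injective morphism into `CX` is automatically fully faithful (`hom_map_le_of_injective`), because
an inequality `a ⊗ c ≤ b` is an equation between finite colimits. Surjectivity has two ingredients.
Uniform density of the image (`exists_uniform_approx`) follows from closure under finite joins,
tensors, scalings and powers: powers normalise a separating function to value `1` at a point, and
iterated tensors push it below any bound elsewhere. Cauchy-completeness makes the image closed for
enriched approximation (`mem_image_of_approx`): a limit `ψ` of values represents a right adjoint
weight on `A`, and the colimit of this weight is a preimage of `ψ`.

For the Łukasiewicz tensor, uniform and enriched approximation coincide. For multiplication,
enriched closeness is closeness of ratios, which follows from uniform closeness only away from `0`.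
There `⊖` is needed: a function is first moved into `[1/2, 1]`, then recovered by subtracting `1/2`
and taking a `1/2`-power.

Conversely, point evaluations separate the elements of `CX`, and `CX` is Cauchy-complete because a
colimit with right adjoint weight is a uniform limit of members of the diagram
(`CMap.vcat_isCauchyComplete`). -/

namespace EnrichedSW

open unitInterval Topology CategoryTheory

/-! ### Arithmetic of the tensor -/

namespace TNorm

variable (T : TNorm)

theorem one_tensor (a : I) : T.tensor 1 a = a := by rw [T.tensor_comm, T.tensor_one]

theorem zero_tensor (a : I) : T.tensor 0 a = 0 :=
  le_antisymm ((T.tensor_mono_right 0 a.2.2).trans (T.tensor_one 0).le) bot_le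

theorem tensor_le_left (a b : I) : T.tensor a b ≤ a :=
  (T.tensor_mono_right a b.2.2).trans (T.tensor_one a).le

theorem tensor_le_right (a b : I) : T.tensor a b ≤ b := by
  rw [T.tensor_comm]
  exact T.tensor_le_left b a

/-- Powers with respect to the tensor. -/
def npow (a : I) : ℕ → I
  | 0 => 1
  | n + 1 => T.tensor a (npow a n)

theorem npow_mono {a b : I} (h : a ≤ b) (n : ℕ) : T.npow a n ≤ T.npow b n := by
  induction n with
  | zero => exact le_rfl
  | succ n ih => exact T.tensor_mono h ih

theorem npow_one (n : ℕ) : T.npow 1 n = 1 := by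
  induction n with
  | zero => rfl
  | succ n ih => rw [npow, ih, T.tensor_one]

/-- The tensor dominates the Łukasiewicz tensor. -/
def GeLuk : Prop := ∀ a b : I, (a : ℝ) + b - 1 ≤ T.tensor a b

/-- Powers of elements smaller than `1` become arbitrarily small. -/
def Archimedean : Prop := ∀ a : I, a < 1 → ∀ ε : ℝ, 0 < ε → ∃ n, (T.npow a n : ℝ) < ε

end TNorm

theorem luk_geLuk : luk.GeLuk := fun _ _ => le_max_right _ _

theorem mult_geLuk : mult.GeLuk := fun a b => by
  change (a : ℝ) + b - 1 ≤ (a * b : I)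
  rw [Set.Icc.coe_mul]
  nlinarith [a.2.2, b.2.2]

theorem luk_archimedean : luk.Archimedean := fun a ha ε hε => by
  have ha' : (a : ℝ) < 1 := ha
  -- Each further factor lowers the value by `1 - a` until it reaches `0`.
  have key : ∀ n : ℕ, (luk.npow a n : ℝ) ≤ max 0 (1 - (n : ℝ) * (1 - (a : ℝ))) := fun n => by
    induction n with
    | zero => simp [TNorm.npow]
    | succ n ih =>
      change max 0 ((a : ℝ) + luk.npow a n - 1) ≤ _
      push_cast
      refine max_le (le_max_left _ _) ?_
      rcases le_max_iff.1 ih with h | h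
      · exact le_max_of_le_left (by linarith)
      · exact le_max_of_le_right (by linarith)
  obtain ⟨n, hn⟩ := exists_nat_gt (1 / (1 - (a : ℝ)))
  rw [div_lt_iff₀ (by linarith)] at hn
  exact ⟨n, ((key n).trans (max_le le_rfl (by linarith))).trans_lt hε⟩

theorem mult_archimedean : mult.Archimedean := fun a ha ε hε => by
  obtain ⟨n, hn⟩ := exists_pow_lt_of_lt_one hε (show (a : ℝ) < 1 from ha)
  have key : ∀ n : ℕ, (mult.npow a n : ℝ) = (a : ℝ) ^ n := fun n => by
    induction n with
    | zero => simp [TNorm.npow]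
    | succ n ih =>
      rw [pow_succ', ← ih]
      rfl
  exact ⟨n, (key n).trans_lt hn⟩

/-! ### Uniqueness of colimits and powers -/

theorem IsPower.unique {T : TNorm} {X : VCat.{u} T} (hX : X.IsSeparated) {x p q : X.carrier}
    {c : I} (hp : IsPower X x c p) (hq : IsPower X x c q) : p = q := by
  apply hX
  · rw [VCat.LE, ← hq, hp]
    exact X.one_le_hom p
  · rw [VCat.LE, ← hp, hq]
    exact X.one_le_hom q

theorem unitVCat_isPower (T : TNorm) (a c : I) : IsPower (unitVCat T) a c (T.hom c a : I) :=
  fun (b : I) => T.hom_comm c b a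

theorem PowMonHom.map_colimit {T : TNorm} {A : PowMonObj.{u} T} (φ : PowMonHom A (unitObj T))
    {D : VCat.{0} T} {h : D.carrier → A.carrier} {ψ : D.carrier → (VCat.one T).carrier → I}
    (hD : Finite D.carrier) (hh : IsVFunctor D A.toVCat h) (hψ : IsDistributor D (VCat.one T) ψ)
    {x₀ : A.carrier} (hx : IsColimit A.toVCat D h ψ x₀) :
    φ.toFun x₀ = (⨆ z, T.tensor (φ.toFun (h z)) (ψ z ()) : I) :=
  (φ.finCocontinuous.2 D h ψ hD hh hψ x₀ hx).unique (unitVCat_isSeparated T)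
    (unitVCat_isColimit T D _ ψ)

theorem PowMonHom.map_power {T : TNorm} {A : PowMonObj.{u} T} (φ : PowMonHom A (unitObj T))
    {x p : A.carrier} {c : I} (hp : IsPower A.toVCat x c p) :
    φ.toFun p = T.hom c (φ.toFun x) :=
  (φ.preservesPowers x c p hp).unique (unitVCat_isSeparated T) (unitVCat_isPower T _ c)

/-! ### Finite colimits over discrete shapes -/

open Classical in
/-- The discrete `[0,1]`-category on a type. -/
noncomputable def VCat.discrete (T : TNorm) (ι : Type u) : VCat.{u} T where
  carrier := ι
  hom i j := if i = j then 1 else 0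
  one_le_hom i := by simp
  hom_trans i j k := by
    by_cases h : i = j
    · subst h
      simpa using T.tensor_le_right _ _
    · simp [h, T.zero_tensor]

open Classical in
theorem VCat.discrete_isVFunctor {T : TNorm} {ι : Type u} (X : VCat.{v} T) (h : ι → X.carrier) :
    IsVFunctor (VCat.discrete T ι) X h := fun i j => by
  change (if i = j then 1 else 0 : I) ≤ _
  split_ifs with hij
  · subst hij
    exact X.one_le_hom _
  · exact bot_le

open Classical in
theorem VCat.discrete_isDistributor {T : TNorm} {ι : Type u} (ψ : ι → I) :
    IsDistributor (VCat.discrete T ι) (VCat.one T) fun i _ => ψ i := by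
  refine ⟨fun i _ => iSup_le fun j => ?_, fun i _ => iSup_le fun _ => T.tensor_le_left _ _⟩
  change T.tensor (if i = j then 1 else 0 : I) (ψ j) ≤ ψ i
  split_ifs with hij
  · subst hij
    exact T.tensor_le_right _ _
  · rw [T.zero_tensor]
    exact bot_le

/-- Over a discrete shape functoriality and the distributor laws are vacuous, so arbitrary finite
families and weights are allowed: these colimits are the finite joins of elements `h i ⊗ ψ i`. -/
theorem MonObj.exists_discrete_colimit {T : TNorm} (A : MonObj.{u} T) {ι : Type} [Finite ι]
    (h : ι → A.carrier) (ψ : ι → I) :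
    ∃ x₀, IsColimit A.toVCat (VCat.discrete T ι) h (fun i _ => ψ i) x₀ :=
  A.finCocomplete _ h _ ‹_› (VCat.discrete_isVFunctor A.toVCat h)
    (VCat.discrete_isDistributor ψ)

/-! ### The image of a morphism into `CX` -/

section Image

variable {T : TNorm} {hT : ∀ c, Continuous (T.hom c)} {A : PowMonObj.{u} T} {X : PosComp.{v}}
  (ev : PowMonHom A (CMap.obj T hT X))

/-- The value of a morphism into `CX`, as a map on `X`. -/
def PowMonHom.eval (a : A.carrier) : CMap X := ev.toFun a

/-- The set of all values of a morphism into `CX`. -/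
def PowMonHom.image : Set (CMap X) := Set.range ev.eval

theorem one_mem_image : CMap.one X ∈ ev.image := ⟨A.unit, ev.map_unit⟩

theorem tensor_mem_image {f g : CMap X} (hf : f ∈ ev.image)
    (hg : g ∈ ev.image) : CMap.tensor T f g ∈ ev.image := by
  obtain ⟨a, rfl⟩ := hf
  obtain ⟨b, rfl⟩ := hg
  exact ⟨A.mul a b, ev.map_mul a b⟩

theorem power_mem_image {f : CMap X} (hf : f ∈ ev.image) (c : I) :
    CMap.power T hT f c ∈ ev.image := by
  obtain ⟨a, rfl⟩ := hf
  obtain ⟨p, hp⟩ := A.powered a c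
  exact ⟨p, (ev.preservesPowers a c p hp).unique (CMap.vcat_isSeparated T X)
    (CMap.power_isPower T hT _ c)⟩

theorem PowMonHom.eval_colimit {D : VCat.{0} T} [hD : Finite D.carrier]
    {h : D.carrier → A.carrier} {ψ : D.carrier → (VCat.one T).carrier → I}
    (hh : IsVFunctor D A.toVCat h) (hψ : IsDistributor D (VCat.one T) ψ)
    {x₀ : A.carrier} (hx : IsColimit A.toVCat D h ψ x₀) :
    ev.eval x₀ = CMap.colim T (fun z => ev.eval (h z)) fun z => ψ z () :=
  (ev.finCocontinuous.2 D h ψ hD hh hψ x₀ hx).unique (CMap.vcat_isSeparated T X)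
    (CMap.vcat_isColimit T D _ ψ)

theorem map_discrete_colimit {ι : Type} [hι : Finite ι] {h : ι → A.carrier} {ψ : ι → I}
    {x₀ : A.carrier} (hx : IsColimit A.toVCat (VCat.discrete T ι) h (fun i _ => ψ i) x₀) :
    ev.eval x₀ = CMap.colim T (fun i => ev.eval (h i)) ψ :=
  ev.eval_colimit (hD := hι) (VCat.discrete_isVFunctor A.toVCat h)
    (VCat.discrete_isDistributor ψ) hx

theorem colim_mem_image {ι : Type} [Finite ι] {h : ι → CMap X}
    (hh : ∀ i, h i ∈ ev.image) (ψ : ι → I) :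
    CMap.colim T h ψ ∈ ev.image := by
  choose k hk using hh
  obtain rfl : (fun i => ev.eval (k i)) = h := funext hk
  obtain ⟨x₀, hx⟩ := A.exists_discrete_colimit k ψ
  exact ⟨x₀, map_discrete_colimit ev hx⟩

theorem exists_sup_mem_image {f g : CMap X} (hf : f ∈ ev.image)
    (hg : g ∈ ev.image) : ∃ k ∈ ev.image, ∀ x, k x = f x ⊔ g x := by
  refine ⟨_, colim_mem_image ev (h := fun b : Bool => cond b f g) (by simp [hf, hg])
    fun _ => 1, fun x => ?_⟩
  change (⨆ b : Bool, T.tensor ((cond b f g) x) 1) = _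
  simp [iSup_bool_eq, T.tensor_one]

theorem exists_scale_mem_image {f : CMap X} (hf : f ∈ ev.image) (c : I) :
    ∃ k ∈ ev.image, ∀ x, k x = T.tensor (f x) c :=
  ⟨_, colim_mem_image ev (h := fun _ : Unit => f) (fun _ => hf) fun _ => c, fun _ => ciSup_const⟩

theorem npow_mem_image {f : CMap X} (hf : f ∈ ev.image) (n : ℕ) :
    ∃ k ∈ ev.image, ∀ x, k x = T.npow (f x) n := by
  induction n with
  | zero => exact ⟨_, one_mem_image ev, fun _ => rfl⟩
  | succ n ih =>
    obtain ⟨k, hk, hk'⟩ := ih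
    exact ⟨_, tensor_mem_image ev hf hk, fun x => congrArg (T.tensor (f x)) (hk' x)⟩

/-- An injective morphism into `CX` is fully faithful. -/
theorem hom_map_le_of_injective (hev : Function.Injective ev.toFun) (a b : A.carrier) :
    (CMap.vcat T X).hom (ev.eval a) (ev.eval b) ≤ A.hom a b := by
  set c : I := (CMap.vcat T X).hom (ev.eval a) (ev.eval b) with hc
  -- The colimit is `(a ⊗ c) ∨ b`. By the choice of `c` its image is that of `b`, so by injectivity
  -- it is `b`; testing the colimit formula against `b` itself then yields `c ≤ A.hom a b`.
  obtain ⟨x₀, hx⟩ := A.exists_discrete_colimit (fun i : Bool => cond i a b) fun i => cond i c 1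
  have h0 : x₀ = b := hev <| by
    refine (map_discrete_colimit ev hx).trans (DFunLike.ext (F := CMap X) _ _ fun x => ?_)
    change (⨆ i : Bool, T.tensor ((ev.eval (cond i a b) : CMap X) x) (cond i c 1)) = _
    rw [iSup_bool_eq]
    simp only [cond_true, cond_false, T.tensor_one]
    refine sup_eq_right.2 ?_
    rw [← T.le_hom_iff]
    exact iInf_le _ x
  subst h0
  have h1 : 1 ≤ T.hom c (A.hom a x₀) :=
    ((A.one_le_hom x₀).trans (hx x₀).le).trans (iInf_le _ true)
  exact T.one_le_hom_iff.1 h1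

/-! ### A Stone–Weierstraß theorem for antitone maps -/

variable (hA : T.Archimedean)
  (hev : ∀ x y : X.carrier,
    (∀ a, (ev.eval a : CMap X) y ≤ (ev.eval a : CMap X) x) → x ≤ y)

include hA hev

/-- Some value `f` of the morphism has `f y < f x`. The power `hom (f x) f` equals `1` at `x` and is
smaller than `1` at `y`; its iterated tensors stay `1` at `x` and become small near `y`. -/
theorem exists_separating {x y : X.carrier} (hxy : ¬ y ≤ x) {ε : ℝ} (hε : 0 < ε) :
    ∃ g ∈ ev.image, g x = 1 ∧ ∀ᶠ z in 𝓝 y, (g z : ℝ) < ε := by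
  have h1 : ∃ f ∈ ev.image, (f : CMap X) y < f x := by
    by_contra! h
    exact hxy (hev y x fun a => h _ ⟨a, rfl⟩)
  obtain ⟨f, hf, hlt⟩ := h1
  set g := CMap.power T hT f (f x) with hg
  have hgx : g x = 1 := le_antisymm (g x).2.2 (T.one_le_hom_iff.2 le_rfl)
  have hgy : g y < 1 := not_le.1 fun h => hlt.not_ge (T.one_le_hom_iff.1 h)
  -- The slack between `g y` and `c` lets one exponent serve a whole neighbourhood of `y`.
  obtain ⟨c, hc, hc1⟩ := exists_between hgy
  obtain ⟨n, hn⟩ := hA c hc1 ε hε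
  obtain ⟨k, hk, hk'⟩ := npow_mem_image ev (power_mem_image ev hf (f x)) n
  refine ⟨k, hk, by rw [hk', ← hg, hgx, T.npow_one], ?_⟩
  filter_upwards [g.continuous.continuousAt.eventually_lt_const hc] with z hz
  rw [hk']
  exact lt_of_le_of_lt (Subtype.coe_le_coe.2 (T.npow_mono hz.le n)) hn

/-- Tensoring finitely many of the local functions keeps the value `1` at `x` and stays below each
factor, so smallness passes to finite unions. -/
theorem exists_separating_isCompact {x : X.carrier} {K : Set X.carrier} (hK : IsCompact K)
    (hxK : ∀ y ∈ K, ¬ y ≤ x) {ε : ℝ} (hε : 0 < ε) :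
    ∃ g ∈ ev.image, g x = 1 ∧ ∀ z ∈ K, (g z : ℝ) < ε := by
  refine hK.induction_on (p := fun s => ∃ g ∈ ev.image, g x = 1 ∧
    ∀ z ∈ s, ((g : CMap X) z : ℝ) < ε) ?_ ?_ ?_ ?_
  · exact ⟨_, one_mem_image ev, rfl, by simp⟩
  · rintro s t hst ⟨g, hg, hgx, hgt⟩
    exact ⟨g, hg, hgx, fun z hz => hgt z (hst hz)⟩
  · rintro s t ⟨f, hf, hfx, hfs⟩ ⟨g, hg, hgx, hgt⟩
    refine ⟨_, tensor_mem_image ev hf hg, ?_, ?_⟩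
    · change T.tensor (f x) (g x) = 1
      rw [hfx, hgx, T.tensor_one]
    · rintro z (hz | hz)
      · exact lt_of_le_of_lt (Subtype.coe_le_coe.2 (T.tensor_le_left _ _)) (hfs z hz)
      · exact lt_of_le_of_lt (Subtype.coe_le_coe.2 (T.tensor_le_right _ _)) (hgt z hz)
  · intro y hy
    obtain ⟨g, hg, hgx, hgy⟩ := exists_separating ev hA hev (hxK y hy) hε
    exact ⟨_, mem_nhdsWithin_of_mem_nhds hgy, g, hg, hgx, fun z hz => hz⟩

/-- The image of a point-separating morphism is uniformly dense. -/
theorem exists_uniform_approx (ψ : CMap X) {ε : ℝ} (hε : 0 < ε) :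
    ∃ f ∈ ev.image, ∀ z, (f z : ℝ) < ψ z + ε ∧ (ψ z : ℝ) < f z + ε := by
  have hψ : Continuous fun z => (ψ z : ℝ) := continuous_subtype_val.comp ψ.continuous
  suffices h : ∃ f ∈ ev.image, (∀ z, ((f : CMap X) z : ℝ) < ψ z + ε) ∧
      ∀ z ∈ Set.univ, (ψ z : ℝ) < f z + ε by
    obtain ⟨f, hf, h1, h2⟩ := h
    exact ⟨f, hf, fun z => ⟨h1 z, h2 z trivial⟩⟩
  refine isCompact_univ.induction_on (p := fun s => ∃ f ∈ ev.image,
    (∀ z, ((f : CMap X) z : ℝ) < ψ z + ε) ∧ ∀ z ∈ s, (ψ z : ℝ) < f z + ε) ?_ ?_ ?_ ?_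
  -- The zero function serves the empty set.
  · obtain ⟨k, hk, hk'⟩ := exists_scale_mem_image ev (one_mem_image ev) 0
    refine ⟨k, hk, fun z => ?_, by simp⟩
    rw [hk', T.tensor_comm, T.zero_tensor]
    exact add_pos_of_nonneg_of_pos (ψ z).2.1 hε
  · rintro s t hst ⟨f, hf, h1, h2⟩
    exact ⟨f, hf, h1, fun z hz => h2 z (hst hz)⟩
  · rintro s t ⟨f, hf, hf1, hf2⟩ ⟨g, hg, hg1, hg2⟩
    obtain ⟨k, hk, hk'⟩ := exists_sup_mem_image ev hf hg
    refine ⟨k, hk, fun z => ?_, ?_⟩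
    · rw [hk']
      rcases le_total (f z) (g z) with h | h
      · rw [sup_eq_right.2 h]
        exact hg1 z
      · rw [sup_eq_left.2 h]
        exact hf1 z
    · rintro z (hz | hz)
      · have : (f z : ℝ) ≤ k z := Subtype.coe_le_coe.2 (by simp [hk'])
        linarith [hf2 z hz]
      · have : (g z : ℝ) ≤ k z := Subtype.coe_le_coe.2 (by simp [hk'])
        linarith [hg2 z hz]
  · intro x _
    -- The bump scaled to height `ψ x` can exceed `ψ + ε` only on this set, so it has to be small
    -- there. As `ψ` is antitone, no point of the set lies below `x`, which makes separation
    -- possible.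
    have hK : IsCompact {y | (ψ y : ℝ) + ε ≤ ψ x} :=
      (isClosed_le (hψ.add continuous_const) continuous_const).isCompact
    obtain ⟨g, hg, hgx, hgK⟩ := exists_separating_isCompact ev hA hev hK
      (fun y (hy : (ψ y : ℝ) + ε ≤ ψ x) hyx => by
        have : (ψ x : ℝ) ≤ ψ y := ψ.antitone hyx
        linarith) hε
    obtain ⟨k, hk, hk'⟩ := exists_scale_mem_image ev hg (ψ x)
    have hkx : k x = ψ x := by rw [hk', hgx, T.one_tensor]
    refine ⟨{z | (ψ z : ℝ) < k z + ε}, mem_nhdsWithin_of_mem_nhds ?_, k, hk, fun z => ?_,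
      fun z hz => hz⟩
    · refine (isOpen_lt hψ ((continuous_subtype_val.comp k.continuous).add
        continuous_const)).mem_nhds ?_
      change (ψ x : ℝ) < k x + ε
      rw [hkx]
      linarith
    · by_cases hz : (ψ z : ℝ) + ε ≤ ψ x
      · have h1 : (k z : ℝ) ≤ g z := Subtype.coe_le_coe.2 (by
          rw [hk']
          exact T.tensor_le_left _ _)
        linarith [hgK z hz, (ψ z).2.1]
      · have h1 : (k z : ℝ) ≤ ψ x := Subtype.coe_le_coe.2 (by
          rw [hk']
          exact T.tensor_le_right _ _)
        linarith

end Image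

/-! ### Cauchy-completeness and closed images -/

section Closed

variable {T : TNorm} {hT : ∀ c, Continuous (T.hom c)} {A : PowMonObj.{u} T} {X : PosComp.{v}}
  (ev : PowMonHom A (CMap.obj T hT X))

/-- The image of a Cauchy-complete object under an injective morphism is closed for the topology
induced by the enriched structure. -/
theorem mem_image_of_approx (hA : IsCauchyComplete A.toVCat) (hG : T.GeLuk)
    (hev : Function.Injective ev.toFun) (ψ : CMap X)
    (hψ : ∀ η : ℝ, 0 < η → ∃ f ∈ ev.image, ∀ x,
      1 - η ≤ T.hom (ψ x) (f x) ∧ 1 - η ≤ T.hom (f x) (ψ x)) :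
    ψ ∈ ev.image := by
  let C := CMap.vcat T X
  let E : A.carrier → C.carrier := ev.toFun
  have hE : ∀ a b, A.hom a b = C.hom (E a) (E b) := fun a b =>
    le_antisymm (ev.finCocontinuous.1 a b) (hom_map_le_of_injective ev hev a b)
  let ψ' : C.carrier := ψ
  -- This is the unit inequality of the adjunction between the weights `C.hom ψ' (E -)` and `C.hom
  -- (E -) ψ'`.
  have key : (⨆ a, T.tensor (C.hom ψ' (E a)) (C.hom (E a) ψ')) = 1 := by
    refine le_antisymm le_top ?_
    refine Subtype.coe_le_coe.1 (le_of_forall_pos_le_add fun η hη => ?_)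
    -- With `c = 1 - min (η / 2) 1`, domination of the Łukasiewicz tensor gives `c ⊗ c ≥ 2c - 1 ≥ 1
    -- - η`; the minimum with `1` keeps `c` in the unit interval.
    obtain ⟨_, ⟨a, rfl⟩, hf⟩ := hψ (min (η / 2) 1) (by positivity)
    have hη0 : 0 ≤ 1 - min (η / 2) 1 := by linarith [min_le_right (η / 2) 1]
    let c : I := ⟨1 - min (η / 2) 1, hη0, by linarith [show 0 ≤ min (η / 2) 1 by positivity]⟩
    have h1 : c ≤ C.hom ψ' (E a) := le_iInf fun x => Subtype.coe_le_coe.1 (hf x).1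
    have h2 : c ≤ C.hom (E a) ψ' := le_iInf fun x => Subtype.coe_le_coe.1 (hf x).2
    have h3 : (T.tensor c c : ℝ) ≤
        (⨆ a, T.tensor (C.hom ψ' (E a)) (C.hom (E a) ψ') : I) :=
      Subtype.coe_le_coe.2 ((T.tensor_mono h1 h2).trans
        (le_iSup (fun a => T.tensor (C.hom ψ' (E a)) (C.hom (E a) ψ')) a))
    have h4 : (c : ℝ) + c - 1 ≤ T.tensor c c := hG c c
    have h5 : (c : ℝ) = 1 - min (η / 2) 1 := rfl
    have h6 : ((1 : I) : ℝ) = 1 := rfl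
    linarith [min_le_left (η / 2) 1]
  -- The diagram is the identity of `A`, weighted by the presheaf that `ψ` represents on `A`. Full
  -- faithfulness reduces the distributor laws and the counit to composition in `CX`.
  obtain ⟨x₀, hx₀⟩ := hA A.toVCat (fun a => a) (fun a _ => C.hom (E a) ψ') (fun _ _ => le_rfl) <| by
    refine ⟨⟨fun a _ => iSup_le fun b => ?_, fun a _ => iSup_le fun _ => T.tensor_le_left _ _⟩,
      fun _ a => C.hom ψ' (E a), ⟨fun _ a => iSup_le fun _ => T.tensor_le_right _ _,
        fun _ a => iSup_le fun b => ?_⟩, fun _ _ => key.ge, fun a b => iSup_le fun _ => ?_⟩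
    · rw [hE]
      exact C.hom_trans _ _ _
    · rw [hE]
      exact C.hom_trans _ _ _
    · rw [hE]
      exact C.hom_trans _ _ _
  -- `E x₀` and `ψ` have the same homs into the image. By `key` the image is dense enough around `ψ`
  -- for this to force equality.
  have hx : ∀ a, C.hom (E x₀) (E a) = C.hom ψ' (E a) := fun a => by
    rw [← hE, hx₀]
    refine le_antisymm ?_ (le_iInf fun b => ?_)
    · set c := ⨅ z, T.hom (C.hom (E z) ψ') (A.hom z a) with hc
      -- Writing `c = c ⊗ 1` and expanding `1` by `key` factors the estimate through the elements `E
      -- b`.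
      rw [← T.tensor_one c, ← key, T.tensor_iSup]
      refine iSup_le fun b => ?_
      have h1 : T.tensor (C.hom (E b) ψ') c ≤ C.hom (E b) (E a) := by
        rw [← hE, ← T.le_hom_iff]
        exact iInf_le _ b
      rw [T.tensor_comm, T.tensor_assoc]
      exact (T.tensor_mono_right _ h1).trans (C.hom_trans _ _ _)
    · rw [T.le_hom_iff, hE]
      exact C.hom_trans _ _ _
  refine ⟨x₀, CMap.vcat_isSeparated T X _ _ ?_ ?_⟩
  · change 1 ≤ C.hom (E x₀) ψ'
    rw [← key]
    refine iSup_le fun a => ?_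
    rw [← hx]
    exact C.hom_trans _ _ _
  · change 1 ≤ C.hom ψ' (E x₀)
    rw [← hx]
    exact C.one_le_hom _

end Closed

/-- Since `hom u v = min 1 (1 - u + v)`, uniform `η`-closeness says exactly what enriched closeness
requires. -/
theorem luk_image_eq_univ {A : LukCat.{u}} {X : PosComp.{v}}
    (ev : PowMonHom A (CMap.obj luk luk_hom_continuous X)) (hA : IsCauchyComplete A.toVCat)
    (hinj : Function.Injective ev.toFun)
    (hev : ∀ x y : X.carrier, (∀ a, ev.eval a y ≤ ev.eval a x) → x ≤ y) (ψ : CMap X) :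
    ψ ∈ ev.image := by
  refine mem_image_of_approx ev hA luk_geLuk hinj ψ fun η hη => ?_
  obtain ⟨f, hf, h⟩ := exists_uniform_approx ev luk_archimedean hev ψ hη
  refine ⟨f, hf, fun x => ?_⟩
  rw [luk_hom, luk_hom]
  exact ⟨le_min (by linarith) (by linarith [h x]), le_min (by linarith) (by linarith [h x])⟩

/-- The bound `c` is a real number so that `1 - η` may be negative. -/
theorem le_mult_hom {a b : I} {c : ℝ} (hc : c ≤ 1) (h : c * a ≤ b) :
    c ≤ mult.hom a b := by
  rw [mult_hom, multHom]
  split_ifs with ha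
  · exact hc
  · exact le_min ((le_div_iff₀ (lt_of_le_of_ne a.2.1 (Ne.symm ha))).2 h) hc

/-- One half, as an element of the unit interval. -/
noncomputable def half : I := ⟨1 / 2, by norm_num, by norm_num⟩

theorem mult_image_eq_univ {A : MultCat.{u}} {X : PosComp.{v}}
    (ev : PowMonHom A.toPowMonObj (CMap.obj mult mult_hom_continuous X))
    (hminus : ∀ a c, ev.eval (A.minus a c) = CMap.minus (ev.eval a) c)
    (hA : IsCauchyComplete A.toVCat) (hinj : Function.Injective ev.toFun)
    (hev : ∀ x y : X.carrier, (∀ a, ev.eval a y ≤ ev.eval a x) → x ≤ y)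
    (ψ : CMap X) : ψ ∈ ev.image := by
  -- Where `χ ≥ 1/2`, an additive error `η / 2` is at most `η * χ`, hence a relative error at most
  -- `η`.
  have hpos : ∀ χ : CMap X, (∀ x, (1 / 2 : ℝ) ≤ χ x) → χ ∈ ev.image := by
    refine fun χ hχ => mem_image_of_approx ev hA mult_geLuk hinj χ fun η hη => ?_
    obtain ⟨f, hf, h⟩ := exists_uniform_approx ev mult_archimedean hev χ
      (half_pos hη)
    refine ⟨f, hf, fun x => ⟨le_mult_hom (by linarith) ?_, le_mult_hom (by linarith) ?_⟩⟩
    · nlinarith [h x, hχ x]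
    -- For `η ≤ 1` the bound on `f x` may be multiplied by `1 - η ≥ 0`; otherwise `(1 - η) * f x ≤
    -- 0`.
    · rcases le_total η 1 with h1 | h1
      · nlinarith [h x, hχ x]
      · nlinarith [h x, hχ x, (f x).2.1]
  let χ : CMap X := CMap.mk'
    (fun x => ⟨(ψ x : ℝ) / 2 + 1 / 2, by linarith [(ψ x).2.1], by linarith [(ψ x).2.2]⟩)
    (Continuous.subtype_mk
      (((continuous_subtype_val.comp ψ.continuous).div_const 2).add continuous_const) _)
    fun x y h => Subtype.coe_le_coe.1 <| by
      have : (ψ y : ℝ) ≤ ψ x := ψ.antitone h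
      change (ψ y : ℝ) / 2 + 1 / 2 ≤ (ψ x : ℝ) / 2 + 1 / 2
      linarith
  have hχ : ∀ x, (χ x : ℝ) = (ψ x : ℝ) / 2 + 1 / 2 := fun _ => rfl
  obtain ⟨a, ha⟩ := hpos χ fun x => by linarith [(ψ x).2.1, hχ x]
  have hm : CMap.minus χ half ∈ ev.image :=
    ⟨A.minus a half, (hminus a half).trans (congrArg (CMap.minus · half) ha)⟩
  -- `hom (1/2) -` is doubling truncated at `1`, so it inverts the halving in `χ` once the shift is
  -- removed.
  have hψ : CMap.power mult mult_hom_continuous (CMap.minus χ half) half = ψ := by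
    refine DFunLike.ext _ _ fun x => ?_
    change mult.hom half (tminus (χ x) half) = ψ x
    rw [mult_hom, multHom, if_neg (by norm_num [half])]
    refine Subtype.ext ?_
    change min (max ((χ x : ℝ) - 1 / 2) 0 / (1 / 2)) 1 = ψ x
    rw [hχ, max_eq_left (by linarith [(ψ x).2.1]), min_eq_left] <;> linarith [(ψ x).2.2]
  exact hψ ▸ power_mem_image ev hm half

/-! ### The space of characters -/

section Characters

variable {T : TNorm}

/-- The set of all morphisms from `A` into `[0,1]`; the order on `[0,1]` is reversed. -/
def characters (A : PowMonObj.{u} T) : Set (A.carrier → Iᵒᵈ) :=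
  {f | ∃ φ : PowMonHom A (unitObj T), ∀ a, f a = OrderDual.toDual (φ.toFun a : I)}

/-- Uniqueness of colimits and powers in `[0,1]` turns preservation into explicit equations between
coordinates of `f`, each of which is a closed condition. -/
theorem mem_characters_iff (A : PowMonObj.{u} T) (f : A.carrier → Iᵒᵈ) :
    f ∈ characters A ↔
      (∀ a b, A.hom a b ≤ T.hom (f a).ofDual (f b).ofDual) ∧
      (∀ (D : VCat.{0} T) (h : D.carrier → A.carrier)
        (ψ : D.carrier → (VCat.one T).carrier → I), Finite D.carrier → IsVFunctor D A.toVCat h →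
          IsDistributor D (VCat.one T) ψ → ∀ x₀, IsColimit A.toVCat D h ψ x₀ →
            (f x₀).ofDual = ⨆ z, T.tensor (f (h z)).ofDual (ψ z ())) ∧
      (f A.unit).ofDual = 1 ∧
      (∀ a b, (f (A.mul a b)).ofDual = T.tensor (f a).ofDual (f b).ofDual) ∧
      ∀ a c p, IsPower A.toVCat a c p → (f p).ofDual = T.hom c (f a).ofDual := by
  constructor
  · rintro ⟨φ, hφ⟩
    obtain rfl : f = fun a => OrderDual.toDual (φ.toFun a : I) := funext hφ
    exact ⟨φ.finCocontinuous.1, fun D h ψ hD hh hψ x₀ hx => φ.map_colimit hD hh hψ hx,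
      φ.map_unit, φ.map_mul, fun a c p hp => φ.map_power hp⟩
  · rintro ⟨h1, h2, h3, h4, h5⟩
    refine ⟨⟨fun a => ((f a).ofDual : I), ⟨h1, fun D h ψ hD hh hψ x₀ hx => ?_⟩, h3, h4,
      fun a c p hp => ?_⟩, fun _ => rfl⟩
    · have := unitVCat_isColimit T D (fun z => (f (h z)).ofDual) ψ
      rw [← h2 D h ψ hD hh hψ x₀ hx] at this
      exact this
    · have := unitVCat_isPower T (f a).ofDual c
      rw [← h5 a c p hp] at this
      exact this

theorem isClosed_characters (hT : ∀ c, Continuous (T.hom c)) (A : PowMonObj.{u} T) :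
    IsClosed (characters A) := by
  have hc : ∀ a, Continuous fun f : A.carrier → Iᵒᵈ => (f a).ofDual := fun a =>
    continuous_ofDual.comp (continuous_apply a)
  have ht : ∀ {g k : (A.carrier → Iᵒᵈ) → I}, Continuous g → Continuous k →
      Continuous fun f => T.tensor (g f) (k f) := fun hg hk =>
    T.continuous_tensor.comp (hg.prodMk hk)
  rw [show characters A = Set.ofPred _ from Set.ext (mem_characters_iff A)]
  simp only [Set.ofPred_and, Set.ofPred_forall]
  refine IsClosed.inter ?_ (IsClosed.inter ?_ (IsClosed.inter ?_ (IsClosed.inter ?_ ?_)))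
  · refine isClosed_iInter fun a => isClosed_iInter fun b => ?_
    simp only [T.le_hom_iff]
    exact isClosed_le (ht (hc a) continuous_const) (hc b)
  · refine isClosed_iInter fun D => isClosed_iInter fun h => isClosed_iInter fun ψ =>
      isClosed_iInter fun hD => isClosed_iInter fun _ => isClosed_iInter fun _ =>
      isClosed_iInter fun x₀ => isClosed_iInter fun _ => isClosed_eq (hc x₀) ?_
    -- Finiteness of the shape is essential: only finite suprema are continuous in `f` in general.
    have := Fintype.ofFinite D.carrier
    simp only [← Finset.sup_univ_eq_iSup]
    exact Continuous.finset_sup_apply fun z _ => ht (hc _) continuous_const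
  · exact isClosed_eq (hc _) continuous_const
  · exact isClosed_iInter fun a => isClosed_iInter fun b => isClosed_eq (hc _) (ht (hc a) (hc b))
  · exact isClosed_iInter fun a => isClosed_iInter fun c => isClosed_iInter fun p =>
      isClosed_iInter fun _ => isClosed_eq (hc p) ((hT c).comp (hc a))

/-- A closed set of characters, as a partially ordered compact space. -/
def characterSpace {A : PowMonObj.{u} T} (S : Set (A.carrier → Iᵒᵈ)) (hS : IsClosed S) :
    PosComp.{u} :=
  have : CompactSpace S := isCompact_iff_compactSpace.1 hS.isCompact
  { carrier := S }

/-- Evaluation of characters, as a morphism. -/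
def evaluation (hT : ∀ c, Continuous (T.hom c)) {A : PowMonObj.{u} T}
    {S : Set (A.carrier → Iᵒᵈ)} (hS : IsClosed S) (hSA : S ⊆ characters A) :
    PowMonHom A (CMap.obj T hT (characterSpace S hS)) :=
  have hχ := fun f : S => (mem_characters_iff A f.1).1 (hSA f.2)
  let E : A.carrier → CMap (characterSpace S hS) := fun a =>
    CMap.mk' (fun f : S => (f.1 a).ofDual)
      (continuous_ofDual.comp ((continuous_apply a).comp continuous_subtype_val))
      fun f g (h : f.1 ≤ g.1) => h a
  { toFun := E
    finCocontinuous := by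
      refine ⟨fun a b => le_iInf fun f => (hχ f).1 a b, fun D h ψ hD hh hψ x₀ hx => ?_⟩
      have h1 : E x₀ = CMap.colim T (fun z => E (h z)) fun z => ψ z () :=
        DFunLike.ext _ _ fun f => (hχ f).2.1 D h ψ hD hh hψ x₀ hx
      have h2 := CMap.vcat_isColimit T D (fun z => E (h z)) ψ
      rw [← h1] at h2
      exact h2
    map_unit := DFunLike.ext (F := CMap _) _ _ fun f => (hχ f).2.2.1
    map_mul := fun a b => DFunLike.ext (F := CMap _) _ _ fun f => (hχ f).2.2.2.1 a b
    preservesPowers := fun a c p hp => by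
      have h1 : E p = CMap.power T hT (E a) c :=
        DFunLike.ext _ _ fun f => (hχ f).2.2.2.2 a c p hp
      have h2 := CMap.power_isPower T hT (E a) c
      rw [← h1] at h2
      exact h2 }

/-- The order on the character space is the pointwise order of `Iᵒᵈ`, so this order hypothesis of
the density theorem holds by definition. -/
theorem le_of_evaluation_le (hT : ∀ c, Continuous (T.hom c)) {A : PowMonObj.{u} T}
    {S : Set (A.carrier → Iᵒᵈ)} (hS : IsClosed S) (hSA : S ⊆ characters A)
    (x y : (characterSpace S hS).carrier)
    (h : ∀ a, (evaluation hT hS hSA).eval a y ≤ (evaluation hT hS hSA).eval a x) : x ≤ y :=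
  fun a => h a

theorem evaluation_injective (hT : ∀ c, Continuous (T.hom c)) {A : PowMonObj.{u} T}
    {S : Set (A.carrier → Iᵒᵈ)} (hS : IsClosed S) (hSA : S ⊆ characters A)
    (hsep : ∀ a b : A.carrier, (∀ f ∈ S, f a = f b) → a = b) :
    Function.Injective (evaluation hT hS hSA).toFun := fun a b hab => hsep a b fun f hf =>
  DFunLike.congr_fun (F := CMap (characterSpace S hS)) hab ⟨f, hf⟩

end Characters

/-! ### Inverses -/

/-- The inverse of a bijective fully faithful morphism. -/
noncomputable def PowMonHom.inverse {T : TNorm} {A : PowMonObj.{u} T} {B : PowMonObj.{v} T}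
    (f : PowMonHom A B) (g : B.carrier → A.carrier) (hfg : ∀ b, f.toFun (g b) = b)
    (hgf : ∀ a, g (f.toFun a) = a)
    (hf : ∀ a a', B.hom (f.toFun a) (f.toFun a') ≤ A.hom a a') : PowMonHom B A :=
  have hf' : ∀ a a', A.hom a a' = B.hom (f.toFun a) (f.toFun a') := fun a a' =>
    le_antisymm (f.finCocontinuous.1 a a') (hf a a')
  { toFun := g
    finCocontinuous :=
      ⟨fun x y => by rw [hf', hfg, hfg], fun D h ψ _ _ _ x₀ hx a => by
        simp only [hf', hfg]
        exact hx (f.toFun a)⟩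
    map_unit := by rw [← f.map_unit, hgf]
    map_mul := fun x y => by
      rw [← hgf (A.mul _ _), f.map_mul, hfg, hfg]
    preservesPowers := fun x c p hp a => by
      rw [hf', hf', hfg, hfg]
      exact hp (f.toFun a) }

/-! ### The objects `CX` are Cauchy-complete with enough characters -/

theorem IsCauchyComplete.of_equiv {T : TNorm} {X Y : VCat.{u} T} (hY : IsCauchyComplete Y)
    {f : X.carrier → Y.carrier} {g : Y.carrier → X.carrier} (hf : IsVFunctor X Y f)
    (hg : IsVFunctor Y X g) (hfg : ∀ y, f (g y) = y) (hgf : ∀ x, g (f x) = x) :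
    IsCauchyComplete X := by
  intro D h ψ hh hψ
  obtain ⟨y₀, hy₀⟩ := hY D (fun z => f (h z)) ψ (fun a b => (hh a b).trans (hf _ _)) hψ
  have hf' : ∀ x x', X.hom x x' = Y.hom (f x) (f x') := fun x x' =>
    le_antisymm (hf x x') ((hg _ _).trans (by rw [hgf, hgf]))
  refine ⟨g y₀, fun x => ?_⟩
  simp only [hf', hfg]
  exact hy₀ (f x)

/-- The pointwise supremum is the colimit as soon as it is continuous. The unit of the adjunction
provides `z` with both `l z` and `ψ z` close to `1`, and for such `z` the single function `h z` is
uniformly close to the supremum. -/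
theorem CMap.vcat_isCauchyComplete (T : TNorm) (hG : T.GeLuk) (X : PosComp.{u}) :
    IsCauchyComplete (CMap.vcat T X) := by
  rintro D h ψ hh ⟨-, l, -, hl, hl'⟩
  let h' : D.carrier → CMap X := h
  let F : X.carrier → I := fun x => ⨆ z, T.tensor (h' z x) (ψ z ())
  have happrox : ∀ ε : ℝ, 0 < ε → ∃ f : CMap X, ∀ x, |(F x : ℝ) - f x| < ε := by
    intro ε hε
    have h1 : (1 : I) ≤ ⨆ z, T.tensor (l () z) (ψ z ()) := hl () ()
    have h2 : ∃ z, (1 : ℝ) - ε < T.tensor (l () z) (ψ z ()) := by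
      by_contra! hcon
      -- The number `1 - ε` is clamped to the unit interval, as `ε` may exceed `1`.
      have h3 : (⨆ z, T.tensor (l () z) (ψ z ())) ≤ Set.projIcc 0 1 zero_le_one (1 - ε) :=
        iSup_le fun z => Subtype.coe_le_coe.1 <| by
          rw [Set.coe_projIcc]
          exact le_max_of_le_right (le_min (T.tensor _ _).2.2 (hcon z))
      have h4 : (1 : ℝ) ≤ Set.projIcc (0 : ℝ) 1 zero_le_one (1 - ε) :=
        Subtype.coe_le_coe.2 (h1.trans h3)
      rw [Set.coe_projIcc] at h4
      rcases le_max_iff.1 h4 with h5 | h5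
      · linarith
      · linarith [min_le_right 1 (1 - ε)]
    obtain ⟨z, hz⟩ := h2
    have hz1 : (1 : ℝ) - ε < l () z :=
      hz.trans_le (Subtype.coe_le_coe.2 (T.tensor_le_left _ _))
    have hz2 : (1 : ℝ) - ε < ψ z () :=
      hz.trans_le (Subtype.coe_le_coe.2 (T.tensor_le_right _ _))
    refine ⟨h' z, fun x => abs_sub_lt_iff.2 ⟨?_, ?_⟩⟩
    -- The counit gives `ψ w ⊗ l z ≤ D.hom w z`, and functoriality of `h` carries this to `hom (h w
    -- x) (h z x)`.
    · have h3 : T.tensor (F x) (l () z) ≤ h' z x := by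
        rw [T.tensor_comm, T.tensor_iSup]
        refine iSup_le fun w => ?_
        have h4 : T.tensor (ψ w ()) (l () z) ≤ T.hom (h' w x) (h' z x) :=
          (((le_iSup (fun i => T.tensor (ψ w i) (l i z)) ()).trans (hl' w z)).trans
            (hh w z)).trans (iInf_le _ x)
        rw [T.tensor_comm, T.tensor_assoc]
        exact T.le_hom_iff.1 h4
      have h4 : (T.tensor (F x) (l () z) : ℝ) ≤ h' z x := Subtype.coe_le_coe.2 h3
      linarith [hG (F x) (l () z)]
    · have h4 : (T.tensor (h' z x) (ψ z ()) : ℝ) ≤ F x :=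
        Subtype.coe_le_coe.2 (le_iSup (fun z => T.tensor (h' z x) (ψ z ())) z)
      linarith [hG (h' z x) (ψ z ())]
  have hF : Continuous F := by
    refine Continuous.subtype_mk (f := fun x => (F x : ℝ)) ?_ fun x => (F x).2
    refine continuous_of_uniform_approx_of_continuous fun u hu => ?_
    obtain ⟨ε, hε, hu⟩ := Metric.mem_uniformity_dist.1 hu
    obtain ⟨f, hf⟩ := happrox ε hε
    exact ⟨fun x => f x, continuous_subtype_val.comp f.continuous, fun x => hu (hf x)⟩
  refine ⟨CMap.mk' F hF fun x y hxy => iSup_mono fun z =>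
    T.tensor_mono ((h' z).antitone hxy) le_rfl, fun (g : CMap X) => ?_⟩
  change (⨅ x, T.hom (⨆ z, T.tensor (h' z x) (ψ z ())) (g x)) =
    ⨅ z, T.hom (ψ z ()) (⨅ x, T.hom (h' z x) (g x))
  simp only [T.iSup_tensor_hom, T.hom_iInf]
  exact iInf_comm

/-- Evaluation at a point, as a morphism from `CX` into `[0,1]`. -/
noncomputable def CMap.evalHom (T : TNorm) (hT : ∀ c, Continuous (T.hom c)) {X : PosComp.{u}}
    (x : X.carrier) : PowMonHom (CMap.obj T hT X) (unitObj T) where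
  toFun f := (show CMap X from f) x
  finCocontinuous := by
    refine ⟨fun f g => iInf_le _ x, fun D h ψ _ _ _ f hf => ?_⟩
    obtain rfl : f = _ := hf.unique (CMap.vcat_isSeparated T X) (CMap.vcat_isColimit T D h ψ)
    exact unitVCat_isColimit T D (fun z => (show CMap X from h z) x) ψ
  map_unit := rfl
  map_mul _ _ := rfl
  preservesPowers f c p hp := by
    obtain rfl : p = _ := hp.unique (CMap.vcat_isSeparated T X) (CMap.power_isPower T hT f c)
    exact unitVCat_isPower T _ c

/-! ### The two equivalences -/

theorem LukCat.exists_iso_iff (A : LukCat.{u}) :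
    (∃ X : PosComp.{u}, Nonempty (Iso A (LukCat.C X))) ↔
      IsCauchyComplete A.toVCat ∧ LukCat.HasEnoughCharacters A := by
  constructor
  · rintro ⟨X, ⟨i⟩⟩
    let f : PowMonHom A (CMap.obj luk luk_hom_continuous X) := i.hom
    let g : PowMonHom (CMap.obj luk luk_hom_continuous X) A := i.inv
    have hgf : ∀ a, g.toFun (f.toFun a) = a := congrFun (congrArg PowMonHom.toFun i.hom_inv_id)
    have hfg : ∀ b, f.toFun (g.toFun b) = b := congrFun (congrArg PowMonHom.toFun i.inv_hom_id)
    refine ⟨(CMap.vcat_isCauchyComplete luk luk_geLuk X).of_equiv f.finCocontinuous.1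
      g.finCocontinuous.1 hfg hgf, fun a b hab => ?_⟩
    rw [← hgf a, ← hgf b]
    -- Point evaluations composed with the isomorphism are characters of `A`, and they already
    -- separate points.
    exact congrArg g.toFun (DFunLike.ext (F := CMap X) _ _ fun x =>
      hab ((CMap.evalHom luk luk_hom_continuous x).comp f))
  · rintro ⟨hA, hsep⟩
    have hS := isClosed_characters luk_hom_continuous A
    let X := characterSpace (characters A) hS
    let f : PowMonHom A (CMap.obj luk luk_hom_continuous X) :=
      evaluation luk_hom_continuous hS subset_rfl
    have hinj : Function.Injective f.toFun :=
      evaluation_injective luk_hom_continuous hS subset_rfl fun a b hab => hsep a b fun φ =>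
        hab (fun a => OrderDual.toDual (φ.toFun a : I)) ⟨φ, fun _ => rfl⟩
    choose g hfg using luk_image_eq_univ f hA hinj
      (le_of_evaluation_le luk_hom_continuous hS subset_rfl)
    have hgf : ∀ a, g (f.toFun a) = a := fun a => hinj (hfg _)
    exact ⟨X, ⟨{
      hom := f
      inv := f.inverse g hfg hgf (hom_map_le_of_injective f hinj)
      hom_inv_id := PowMonHom.ext (funext hgf)
      inv_hom_id := PowMonHom.ext (funext hfg) }⟩⟩

theorem MultCat.exists_iso_iff (A : MultCat.{u}) :
    (∃ X : PosComp.{u}, Nonempty (Iso A (MultCat.C X))) ↔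
      IsCauchyComplete A.toVCat ∧ MultCat.HasEnoughCharacters A := by
  constructor
  · rintro ⟨X, ⟨i⟩⟩
    let f : MinusHom A (CMap.minusObj mult mult_hom_continuous X) := i.hom
    let g : MinusHom (CMap.minusObj mult mult_hom_continuous X) A := i.inv
    have hgf : ∀ a, g.toFun (f.toFun a) = a :=
      congrFun (congrArg (fun k : MinusHom A A => k.toFun) i.hom_inv_id)
    have hfg : ∀ b, f.toFun (g.toFun b) = b :=
      congrFun (congrArg (fun k : MinusHom (MultCat.C X) (MultCat.C X) => k.toFun) i.inv_hom_id)
    refine ⟨(CMap.vcat_isCauchyComplete mult mult_geLuk X).of_equiv f.finCocontinuous.1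
      g.finCocontinuous.1 hfg hgf, fun a b hab => ?_⟩
    rw [← hgf a, ← hgf b]
    exact congrArg g.toFun (DFunLike.ext (F := CMap X) _ _ fun x =>
      hab { (CMap.evalHom mult mult_hom_continuous x).comp f.toPowMonHom with
        map_minus := fun c r => DFunLike.congr_fun (F := CMap X) (f.map_minus c r) x })
  · rintro ⟨hA, hsep⟩
    -- Only characters preserving `⊖` are kept. This further condition is closed as truncated minus
    -- is continuous, and it makes evaluation itself preserve `⊖`.
    let S : Set (A.carrier → Iᵒᵈ) := characters A.toPowMonObj ∩
      {f | ∀ a c, (f (A.minus a c)).ofDual = tminus (f a).ofDual c}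
    have hS : IsClosed S := by
      refine (isClosed_characters mult_hom_continuous A.toPowMonObj).inter ?_
      simp only [Set.ofPred_forall]
      refine isClosed_iInter fun a => isClosed_iInter fun c => isClosed_eq
        (continuous_ofDual.comp (continuous_apply _)) (Continuous.subtype_mk ?_ _)
      exact ((continuous_subtype_val.comp (continuous_ofDual.comp (continuous_apply a))).sub
        continuous_const).max continuous_const
    have hSA : S ⊆ characters A.toPowMonObj := Set.inter_subset_left
    let X := characterSpace S hS
    let f : PowMonHom A.toPowMonObj (CMap.obj mult mult_hom_continuous X) :=
      evaluation mult_hom_continuous hS hSA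
    have hm : ∀ a c, f.eval (A.minus a c) = CMap.minus (f.eval a) c := fun a c =>
      DFunLike.ext _ _ fun x : S => x.2.2 a c
    have hinj : Function.Injective f.toFun :=
      evaluation_injective mult_hom_continuous hS hSA fun a b hab => hsep a b fun φ =>
        hab (fun a => OrderDual.toDual (φ.toFun a : I))
          ⟨⟨φ.toPowMonHom, fun _ => rfl⟩, φ.map_minus⟩
    choose g hfg using mult_image_eq_univ f hm hA hinj
      (le_of_evaluation_le mult_hom_continuous hS hSA)
    have hgf : ∀ a, g (f.toFun a) = a := fun a => hinj (hfg _)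
    have hg : ∀ x c, g (CMap.minus x c) = A.minus (g x) c := fun x c => by
      rw [← hgf (A.minus (g x) c)]
      exact congrArg g ((hm (g x) c).trans (by rw [hfg])).symm
    let f' : A ⟶ MultCat.C X := ({ f with map_minus := hm } : MinusHom _ _)
    let g' : MultCat.C X ⟶ A := (
      { f.inverse g hfg hgf (hom_map_le_of_injective f hinj) with map_minus := hg } :
        MinusHom _ _)
    exact ⟨X, ⟨{
      hom := f'
      inv := g'
      hom_inv_id := MinusHom.ext (A := A) (B := A) (funext hgf)
      inv_hom_id := MinusHom.ext (A := MultCat.C X) (B := MultCat.C X) (funext hfg) }⟩⟩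

end EnrichedSW

theorem mainTheorem5 :
    (∀ A : EnrichedSW.LukCat.{u},
      (∃ X : EnrichedSW.PosComp.{u}, Nonempty (CategoryTheory.Iso A (EnrichedSW.LukCat.C X))) ↔
        EnrichedSW.IsCauchyComplete A.toVCat ∧ EnrichedSW.LukCat.HasEnoughCharacters A) ∧
    (∀ A : EnrichedSW.MultCat.{u},
      (∃ X : EnrichedSW.PosComp.{u}, Nonempty (CategoryTheory.Iso A (EnrichedSW.MultCat.C X))) ↔
        EnrichedSW.IsCauchyComplete A.toVCat ∧ EnrichedSW.MultCat.HasEnoughCharacters A) :=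
  ⟨EnrichedSW.LukCat.exists_iso_iff, EnrichedSW.MultCat.exists_iso_iff⟩
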